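/- All graphs are finite and simple. In the domination game on a graph $G$, Dominator and Staller alternately choose a vertex, Dominator first, such that every chosen vertex dominates (that is, has in its closed neighbourhood) at least one vertex not dominated before; the game ends when all vertices are dominated. Dominator aims to minimize and Staller to maximize the total number of moves, and the game domination number $\gamma_g(G)$ is the number of moves when both play optimally. Let $B$ be the graph obtained from the star $K_{1,4}$ with centre $x$ by adding one edge $yy'$ between two of its leaves. Let $Z$ be the graph with vertices $v_1,\dots,v_9$ and edges $v_1v_2$, $v_2v_3$, $v_3v_4$, $v_4v_9$, $v_9v_8$, $v_8v_7$, $v_7v_6$, $v_6v_1$, $v_7v_2$, $v_8v_5$, $v_5v_4$, $v_5v_9$, $v_3v_8$, and let $z=v_9$. For $k\ge 0$ let $U_k$ be obtained from the disjoint union of the cycle $C_6$ and $B$ by adding an edge between an arbitrary vertex $u$ of $C_6$ and $x$, and then identifying one end vertex of each of $k$ copies of the path $P_6$ on six vertices with $x$. Let $V_k$ be obtained in the same way with $Z$ in place of $C_6$ and $z$ in place of $u$. 1. For every integer $\ell\ge 3$ there is a connected graph $G$ with an edge $e$ such that $\gamma_g(G)=\ell$ and $\gamma_g(G-e)=\ell+2$.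 2. More precisely, for every $k\ge 0$ and each of the two edges $e\in\{xy,xy'\}$, the graphs $U_k$, $U_k-e$, $V_k$ and $V_k-e$ are connected, and $\gamma_g(U_k)=2k+3$, $\gamma_g(U_k-e)=2k+5$, $\gamma_g(V_k)=2k+4$, $\gamma_g(V_k-e)=2k+6$. 3. For $\ell<3$ there is no graph $G$ (connected or not) with an edge $e$ such that $\gamma_g(G)=\ell$ and $\gamma_g(G-e)=\ell+2$. More precisely, for every graph $G$ and every edge $e$ of $G$: if $\gamma_g(G)=1$ then $\gamma_g(G-e)\le 2$, and if $\gamma_g(G)=2$ then $\gamma_g(G-e)\le 3$. -/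

import Mathlib

namespace DominationGame

/-- The closed neighbourhood `N[v]`: the vertices dominated by `v`. -/
def closedNbhd {V : Type*} (G : SimpleGraph V) (v : V) : Set V :=
  {w | w = v ∨ G.Adj v w}

/-- With `S` the set of vertices dominated so far, `v` may be chosen when it dominates at least
one vertex outside `S`. -/
def Legal {V : Type*} (G : SimpleGraph V) (S : Set V) (v : V) : Prop :=
  ∃ w ∈ closedNbhd G v, w ∉ S

/-- The two players of the domination game. -/
inductive Player where
  | dominator
  | staller

theorem ncard_compl_lt {V : Type*} [Finite V] {G : SimpleGraph V} {S : Set V} {v : V}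
    (h : Legal G S v) : (S ∪ closedNbhd G v)ᶜ.ncard < Sᶜ.ncard := by
  obtain ⟨w, hw, hS⟩ := h
  refine Set.ncard_lt_ncard ⟨Set.compl_subset_compl.mpr Set.subset_union_left, fun hsub => ?_⟩
    (Set.toFinite _)
  exact hsub hS (Or.inr hw)

open Classical in
/-- The number of moves made under optimal play, when the vertices of `S` are already dominated and
the given player moves next. Dominator minimizes and Staller maximizes the number of moves; the
game is over when there is no legal move, that is, when all vertices are dominated. -/
noncomputable def moves {V : Type*} [Finite V] (G : SimpleGraph V) : Player → Set V → ℕ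
  | .dominator, S =>
      if ∃ v, Legal G S v then
        1 + ⨅ v : {v : V // Legal G S v}, moves G .staller (S ∪ closedNbhd G v.1)
      else 0
  | .staller, S =>
      if ∃ v, Legal G S v then
        1 + ⨆ v : {v : V // Legal G S v}, moves G .dominator (S ∪ closedNbhd G v.1)
      else 0
termination_by _ S => Sᶜ.ncard
decreasing_by
  · exact ncard_compl_lt v.2
  · exact ncard_compl_lt v.2

/-- The game domination number `γ_g(G)`: Dominator moves first and no vertex is dominated yet. -/
noncomputable def gameDominationNumber {V : Type*} [Finite V] (G : SimpleGraph V) : ℕ :=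
  moves G .dominator ∅

/-- The graph `Z`: the 8-cycle `0 1 2 3 8 7 6 5` with the chords `16` and `27`, and an additional
vertex `4` adjacent to `3`, `7` and `8`. Its distinguished vertex `z` is `8`. -/
def graphZ : SimpleGraph (Fin 9) :=
  SimpleGraph.fromEdgeSet
    {s(0, 1), s(1, 2), s(2, 3), s(3, 8), s(8, 7), s(7, 6), s(6, 5), s(5, 0),
      s(6, 1), s(7, 4), s(4, 3), s(4, 8), s(2, 7)}

/-- Vertices of a graph made of a core, the star part `B` (five vertices, with centre `0`) and `k`
paths, each with five vertices besides its end vertex that is identified with the centre. -/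
abbrev Vertex (W : Type*) (k : ℕ) : Type _ := W ⊕ Fin 5 ⊕ (Fin k × Fin 5)

/-- The `b`-th vertex of `B`; `starVertex 0` is the centre `x`. -/
abbrev starVertex {W : Type*} {k : ℕ} (b : Fin 5) : Vertex W k := Sum.inr (Sum.inl b)

/-- One orientation of each edge of `attach H u k`. -/
def AttachRel {W : Type*} (H : SimpleGraph W) (u : W) (k : ℕ) :
    Vertex W k → Vertex W k → Prop
  -- the edges of the core
  | .inl a, .inl b => H.Adj a b
  -- the edge between `u` and the centre `x`
  | .inl a, .inr (.inl b) => a = u ∧ b = 0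
  -- `B`: the star `K_{1,4}` with centre `0`, and the edge between its leaves `3` and `4`
  | .inr (.inl a), .inr (.inl b) => a = 0 ∨ (a = 3 ∧ b = 4)
  -- the first edge of each path `P_6`, at the end vertex that is identified with `x`
  | .inr (.inl a), .inr (.inr (_, j)) => a = 0 ∧ j = 0
  -- the other edges of the paths `P_6`
  | .inr (.inr (i, j)), .inr (.inr (i', j')) => i = i' ∧ (j : ℕ) + 1 = j'
  | _, _ => False

/-- Take the disjoint union of `H` and `B` (the graph `K_{1,4}` plus an edge, with centre `x`), add
the edge `ux`, and identify one end vertex of each of `k` copies of `P_6` with `x`. -/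
def attach {W : Type*} (H : SimpleGraph W) (u : W) (k : ℕ) : SimpleGraph (Vertex W k) :=
  SimpleGraph.fromRel (AttachRel H u k)

/-- The graph `U_k`, whose 6-cycle is joined to `x` at the vertex `u`. -/
def graphU (u : Fin 6) (k : ℕ) : SimpleGraph (Vertex (Fin 6) k) :=
  attach (SimpleGraph.cycleGraph 6) u k

/-- The graph `V_k`. -/
def graphV (k : ℕ) : SimpleGraph (Vertex (Fin 9) k) :=
  attach graphZ 8 k

end DominationGame

open DominationGame

/-!
The proof has three ingredients: the effect of an edge on the game, the effect of the attached
paths, and the evaluation of a few small games. Everything is deduced from bounds by one move of the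
recursion that defines `moves`, and from the continuation principle `moves_anti`: dominating more
vertices in advance never lengthens the game.

*Edges.* Removing an edge adds at most two moves (`moves_deleteEdges_le`): Dominator plays as in the
original graph until an end of the edge is chosen whose other end `b` is not dominated; from then on
the two games differ only in `b`, and having one vertex dominated in advance is worth at most two
moves (`moves_le_moves_insert_add_two`). For game domination number at most two the increase is at
most one: Dominator keeps the same first move.

*Paths.* Identifying an end of `P_6` with a vertex `x` of an arbitrary graph adds at least two moves
(`moves_add_two_le_tailState`). It adds at most two moves once `x` has been chosen
(`moves_tailState_le_add_two`), because the remainder of the path takes two moves whoever moves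
first, and either player can answer the other there. For the lower bound, the path may also be used
by Dominator to dominate `x` for free; Staller then leaves a single undominated vertex on it, a move
in reserve which makes up for this (`moves_le_moves_tailState_middle`).

*Small games.* Hence the graphs without paths decide: after the choice of `x`, the rest of the game
lasts at most 2 moves on `U_0` and 3 on `V_0`, and without the edge the game lasts at least 5 and 6
moves. These bounds are evaluated with sets of vertices encoded as binary numbers (`lastsAtLeast`).
Therefore `γ_g(G)` is at most `2k + 3` or `2k + 4`, and `γ_g(G - e)` at least two more; as removing
an edge adds at most two, both bounds are attained.
-/

namespace DominationGame

/-! ### Bounding the game by one move -/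

section Moves

variable {V : Type*} {G : SimpleGraph V}

theorem Legal.of_subset {A B : Set V} {v : V} (h : Legal G B v) (hAB : A ⊆ B) : Legal G A v :=
  let ⟨w, hw, hB⟩ := h
  ⟨w, hw, fun hA => hB (hAB hA)⟩

theorem not_legal_iff {S : Set V} {v : V} : ¬ Legal G S v ↔ closedNbhd G v ⊆ S := by
  simp [Legal, Set.subset_def]

theorem mem_closedNbhd_self (v : V) : v ∈ closedNbhd G v := Or.inl rfl

theorem legal_self {S : Set V} {v : V} (h : v ∉ S) : Legal G S v :=
  ⟨v, mem_closedNbhd_self v, h⟩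

theorem exists_legal_iff {S : Set V} : (∃ v, Legal G S v) ↔ S ≠ Set.univ := by
  rw [Set.ne_univ_iff_exists_notMem]
  exact ⟨fun ⟨_, w, _, h⟩ => ⟨w, h⟩, fun ⟨w, h⟩ => ⟨w, legal_self h⟩⟩

variable [Finite V]

/-- Induction along the course of the game: a statement about sets of dominated vertices may be
proved for `S` on the assumption that it holds after every legal move. -/
theorem game_induction (G : SimpleGraph V) {motive : Set V → Prop}
    (h : ∀ S, (∀ v, Legal G S v → motive (S ∪ closedNbhd G v)) → motive S) (S : Set V) :
    motive S := by
  induction hn : Sᶜ.ncard using Nat.strong_induction_on generalizing S with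
  | _ n ih =>
    subst hn
    exact h S fun v hv => ih _ (ncard_compl_lt hv) _ rfl

theorem moves_univ (P : Player) : moves G P Set.univ = 0 := by
  have h : ¬ ∃ v, Legal G Set.univ v := by simp [exists_legal_iff]
  cases P <;> rw [moves, if_neg h]

theorem moves_dominator_le {S : Set V} {v : V} {n : ℕ} (hv : Legal G S v)
    (h : moves G .staller (S ∪ closedNbhd G v) ≤ n) : moves G .dominator S ≤ n + 1 := by
  rw [moves, if_pos ⟨v, hv⟩, add_comm]
  exact Nat.add_le_add_right ((ciInf_le (OrderBot.bddBelow _) (⟨v, hv⟩ : {v // Legal G S v})).trans h) 1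

theorem le_moves_dominator {S : Set V} {n : ℕ} (hS : S ≠ Set.univ)
    (h : ∀ v, Legal G S v → n ≤ moves G .staller (S ∪ closedNbhd G v)) :
    n + 1 ≤ moves G .dominator S := by
  obtain ⟨v, hv⟩ := (exists_legal_iff (G := G)).2 hS
  rw [moves, if_pos ⟨v, hv⟩, add_comm]
  have : Nonempty {v // Legal G S v} := ⟨⟨v, hv⟩⟩
  exact Nat.add_le_add_left (le_ciInf fun w : {v // Legal G S v} => h w.1 w.2) 1

theorem le_moves_staller {S : Set V} {v : V} {n : ℕ} (hv : Legal G S v)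
    (h : n ≤ moves G .dominator (S ∪ closedNbhd G v)) : n + 1 ≤ moves G .staller S := by
  rw [moves, if_pos ⟨v, hv⟩, add_comm]
  exact Nat.add_le_add_left (h.trans (le_ciSup
    (f := fun v : {v // Legal G S v} => moves G .dominator (S ∪ closedNbhd G v.1))
    (Set.toFinite _).bddAbove ⟨v, hv⟩)) 1

theorem moves_staller_le {S : Set V} {n : ℕ}
    (h : ∀ v, Legal G S v → moves G .dominator (S ∪ closedNbhd G v) ≤ n) :
    moves G .staller S ≤ n + 1 := by
  rw [moves]
  split_ifs with hS
  · obtain ⟨v, hv⟩ := hS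
    have : Nonempty {v // Legal G S v} := ⟨⟨v, hv⟩⟩
    rw [add_comm]
    exact Nat.add_le_add_right (ciSup_le fun w : {v // Legal G S v} => h w.1 w.2) 1
  · exact Nat.zero_le _

/-- Dominator has an optimal move. -/
theorem exists_moves_dominator_eq {S : Set V} (hS : S ≠ Set.univ) :
    ∃ v, Legal G S v ∧ moves G .dominator S = moves G .staller (S ∪ closedNbhd G v) + 1 := by
  by_contra! hc
  have : moves G .dominator S + 1 ≤ moves G .dominator S :=
    le_moves_dominator hS fun v hv => by
      have := moves_dominator_le hv le_rfl
      have := hc v hv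
      omega
  omega

/-- Staller has an optimal move. -/
theorem exists_moves_staller_eq {S : Set V} (hS : S ≠ Set.univ) :
    ∃ v, Legal G S v ∧ moves G .staller S = moves G .dominator (S ∪ closedNbhd G v) + 1 := by
  by_contra! hc
  obtain ⟨w, hw⟩ := (exists_legal_iff (G := G)).2 hS
  have h0 := le_moves_staller hw le_rfl
  have : moves G .staller S ≤ moves G .staller S - 2 + 1 :=
    moves_staller_le fun v hv => by
      have := le_moves_staller hv le_rfl
      have := hc v hv
      omega
  have := le_moves_staller hw le_rfl
  have := hc w hw
  omega

theorem moves_pos {P : Player} {S : Set V} (hS : S ≠ Set.univ) : 1 ≤ moves G P S := by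
  cases P with
  | dominator => exact le_moves_dominator hS fun _ _ => Nat.zero_le _
  | staller =>
    obtain ⟨v, hv⟩ := (exists_legal_iff (G := G)).2 hS
    exact le_moves_staller hv (Nat.zero_le _)

theorem moves_le_one {P : Player} {S : Set V}
    (h : ∀ v, Legal G S v → S ∪ closedNbhd G v = Set.univ) : moves G P S ≤ 1 := by
  cases P with
  | staller => exact moves_staller_le fun v hv => by rw [h v hv, moves_univ]
  | dominator =>
    by_cases hS : S = Set.univ
    · simp [hS, moves_univ]
    · obtain ⟨v, hv⟩ := (exists_legal_iff (G := G)).2 hS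
      exact moves_dominator_le hv (by rw [h v hv, moves_univ])

theorem moves_le_one_of_compl_subset {P : Player} {S : Set V} (b : V) (h : ∀ w, w ∉ S → w = b) :
    moves G P S ≤ 1 := by
  refine moves_le_one fun v hv => Set.eq_univ_of_forall fun w => ?_
  by_cases hw : w ∈ S
  · exact Or.inl hw
  · obtain ⟨y, hy, hyS⟩ := hv
    rw [h w hw, ← h y hyS]
    exact Or.inr hy

/-! ### The continuation principle -/

/-- The continuation principle: if more vertices are dominated, the game is not longer. A player
whose optimal move is not available any more plays arbitrarily, which is no loss because the
effect of that move is already present. -/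
theorem moves_anti (P : Player) {A B : Set V} (hAB : A ⊆ B) : moves G P B ≤ moves G P A := by
  induction A using game_induction G generalizing P B with
  | h A ih =>
    by_cases hB : B = Set.univ
    · simp [hB, moves_univ]
    have hA : A ≠ Set.univ := fun h => hB (Set.univ_subset_iff.1 (h ▸ hAB))
    cases P with
    | staller =>
      obtain ⟨v, hv, he⟩ := exists_moves_staller_eq (G := G) hB
      have hvA := hv.of_subset hAB
      rw [he]
      exact le_moves_staller hvA (ih v hvA _ (Set.union_subset_union_left _ hAB))
    | dominator =>
      obtain ⟨v, hv, he⟩ := exists_moves_dominator_eq (G := G) hA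
      rw [he]
      by_cases hvB : Legal G B v
      · exact moves_dominator_le hvB (ih v hv _ (Set.union_subset_union_left _ hAB))
      · obtain ⟨w, hw⟩ := (exists_legal_iff (G := G)).2 hB
        exact moves_dominator_le hw (ih v hv _
          ((Set.union_subset hAB (not_legal_iff.1 hvB)).trans Set.subset_union_left))

/-- Dominator having the move is at most one move worse than Staller having it, even if Staller's
position is improved by part of the effect of a single vertex. -/
theorem moves_dominator_le_staller_add_one {A B : Set V} (v : V) (h : B ⊆ A ∪ closedNbhd G v) :
    moves G .dominator A ≤ moves G .staller B + 1 := by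
  by_cases hA : A = Set.univ
  · simp [hA, moves_univ]
  by_cases hv : Legal G A v
  · exact moves_dominator_le hv (moves_anti _ h)
  · obtain ⟨w, hw⟩ := (exists_legal_iff (G := G)).2 hA
    refine moves_dominator_le hw (moves_anti _ (h.trans ?_))
    exact Set.union_subset Set.subset_union_left
      ((not_legal_iff.1 hv).trans Set.subset_union_left)

/-- Having a vertex dominated in advance shortens the game by at most two moves: Dominator ignores
it until some move of Staller dominates this vertex only; such a move is one extra move and one
change of turn. -/
theorem moves_le_moves_insert_add_two (P : Player) (S : Set V) (b : V) :
    moves G P S ≤ moves G P (insert b S) + 2 := by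
  induction S using game_induction G generalizing P with
  | h S ih =>
    by_cases hb : insert b S = Set.univ
    · have : moves G P S ≤ 1 := moves_le_one_of_compl_subset b fun w hw =>
        (hb.symm ▸ Set.mem_univ w : w ∈ insert b S).resolve_right hw
      omega
    cases P with
    | dominator =>
      obtain ⟨v, hv, he⟩ := exists_moves_dominator_eq (G := G) hb
      have hvS := hv.of_subset (Set.subset_insert b S)
      have := ih v hvS .staller
      rw [← Set.insert_union] at this
      rw [he]
      exact moves_dominator_le hvS this
    | staller =>
      refine moves_staller_le fun v hv => ?_
      by_cases hvb : Legal G (insert b S) v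
      · have h1 := ih v hv .dominator
        have h2 := le_moves_staller hvb le_rfl
        rw [← Set.insert_union] at h1
        omega
      · have hsub : insert b S ⊆ S ∪ closedNbhd G v := by
          obtain ⟨w, hw, hwS⟩ := hv
          rintro a (rfl | ha)
          · obtain rfl := (not_legal_iff.1 hvb hw).resolve_right hwS
            exact Or.inr hw
          · exact Or.inl ha
        exact (moves_anti _ hsub).trans
          (moves_dominator_le_staller_add_one b Set.subset_union_left)

end Moves

/-! ### Removing an edge -/

section DeleteEdge

variable {V : Type*} {G : SimpleGraph V} {a b : V}

theorem closedNbhd_deleteEdges_subset (s : Set (Sym2 V)) (v : V) :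
    closedNbhd (G.deleteEdges s) v ⊆ closedNbhd G v := by
  rintro w (rfl | h)
  · exact Or.inl rfl
  · exact Or.inr (G.deleteEdges_le s h)

/-- A vertex dominated by `v` before the removal of the edge `ab` but not after it is an end of the
edge, and `v` is the other end. -/
theorem eq_of_mem_closedNbhd_of_notMem {v w : V} (h : w ∈ closedNbhd G v)
    (h' : w ∉ closedNbhd (G.deleteEdges {s(a, b)}) v) : v = a ∧ w = b ∨ v = b ∧ w = a := by
  rcases h with rfl | h
  · exact absurd (mem_closedNbhd_self w) h'
  · have : s(v, w) = s(a, b) := by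
      by_contra hne
      exact h' (Or.inr (by rw [SimpleGraph.deleteEdges_adj]; exact ⟨h, hne⟩))
    simpa using this

/-- As long as the ends of an edge are dominated, the removal of the edge does not change what a
move does. -/
theorem union_closedNbhd_deleteEdges {S : Set V} {v : V}
    (h : (v = a → b ∈ S) ∧ (v = b → a ∈ S)) :
    S ∪ closedNbhd (G.deleteEdges {s(a, b)}) v = S ∪ closedNbhd G v := by
  refine Set.Subset.antisymm
    (Set.union_subset_union_right _ (closedNbhd_deleteEdges_subset _ v)) ?_
  rintro w (hw | hw)
  · exact Or.inl hw
  · by_contra hc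
    rw [Set.mem_union, not_or] at hc
    rcases eq_of_mem_closedNbhd_of_notMem hw hc.2 with ⟨rfl, rfl⟩ | ⟨rfl, rfl⟩
    · exact hc.1 (h.1 rfl)
    · exact hc.1 (h.2 rfl)

theorem legal_iff_union_ne {S : Set V} {v : V} : Legal G S v ↔ S ∪ closedNbhd G v ≠ S := by
  rw [Ne, Set.union_eq_left, ← not_legal_iff, not_not]

variable [Finite V]

/-- If all moves have the same effect in two graphs, then so does the game. -/
theorem moves_congr {G' : SimpleGraph V} (P : Player) {S : Set V}
    (h : ∀ T v, S ⊆ T → T ∪ closedNbhd G' v = T ∪ closedNbhd G v) :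
    moves G' P S ≤ moves G P S := by
  induction S using game_induction G generalizing P with
  | h S ih =>
    have hl : ∀ v, Legal G' S v ↔ Legal G S v := fun v => by
      rw [legal_iff_union_ne, legal_iff_union_ne, h S v subset_rfl]
    have ih' : ∀ P v, Legal G S v →
        moves G' P (S ∪ closedNbhd G' v) ≤ moves G P (S ∪ closedNbhd G v) := fun P v hv => by
      rw [h S v subset_rfl]
      exact ih v hv P fun T w hT => h T w (Set.subset_union_left.trans hT)
    by_cases hS : S = Set.univ
    · simp [hS, moves_univ]
    cases P with
    | dominator =>
      obtain ⟨v, hv, he⟩ := exists_moves_dominator_eq (G := G) hS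
      rw [he]
      exact moves_dominator_le ((hl v).2 hv) (ih' _ v hv)
    | staller =>
      obtain ⟨v, hv, he⟩ := exists_moves_staller_eq (G := G') hS
      rw [he]
      exact le_moves_staller ((hl v).1 hv) (ih' _ v ((hl v).1 hv))

/-- The part of `moves_deleteEdges_le` in which an end `a` of the edge `ab` is chosen while `b` is
not yet dominated: afterwards the two games differ only in whether `b` is dominated. -/
theorem moves_deleteEdges_le_of_end (P : Player) {S : Set V} :
    moves (G.deleteEdges {s(a, b)}) P (S ∪ closedNbhd (G.deleteEdges {s(a, b)}) a) ≤
      moves G P (S ∪ closedNbhd G a) + 2 := by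
  set G' := G.deleteEdges {s(a, b)} with hG'
  refine (moves_le_moves_insert_add_two P _ b).trans (Nat.add_le_add_right ?_ 2)
  have hsub : S ∪ closedNbhd G a ⊆ insert b (S ∪ closedNbhd G' a) := by
    rintro w (hw | hw)
    · exact Or.inr (Or.inl hw)
    · by_cases hw' : w ∈ closedNbhd G' a
      · exact Or.inr (Or.inr hw')
      · rcases eq_of_mem_closedNbhd_of_notMem hw hw' with ⟨_, rfl⟩ | ⟨rfl, rfl⟩
        · exact Or.inl rfl
        · exact Or.inl rfl
  refine (moves_congr (G := G) P fun T v hT => ?_).trans (moves_anti P hsub)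
  exact union_closedNbhd_deleteEdges
    ⟨fun _ => hT (Or.inl rfl), fun _ => hT (Or.inr (Or.inr (mem_closedNbhd_self a)))⟩

/-- Removing an edge lengthens the game by at most two moves: until an end of the edge is chosen
whose other end is not yet dominated, Dominator plays as in the original graph. -/
theorem moves_deleteEdges_le (G : SimpleGraph V) (e : Sym2 V) (P : Player) (S : Set V) :
    moves (G.deleteEdges {e}) P S ≤ moves G P S + 2 := by
  induction e using Sym2.ind with
  | _ a b =>
  set G' := G.deleteEdges {s(a, b)} with hG'
  induction S using game_induction G generalizing P with
  | h S ih =>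
    have hend : ∀ P v, Legal G S v →
        moves G' P (S ∪ closedNbhd G' v) ≤ moves G P (S ∪ closedNbhd G v) + 2 := by
      intro P v hv
      by_cases h : (v = a → b ∈ S) ∧ (v = b → a ∈ S)
      · rw [hG', union_closedNbhd_deleteEdges h]
        exact ih v hv P
      · by_cases hva : v = a
        · subst hva
          exact moves_deleteEdges_le_of_end P
        · have hvb : v = b := by tauto
          subst hvb
          have := moves_deleteEdges_le_of_end (G := G) (a := v) (b := a) (S := S) P
          rwa [Sym2.eq_swap] at this
    by_cases hS : S = Set.univ
    · simp [hS, moves_univ]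
    cases P with
    | dominator =>
      obtain ⟨v, hv, he⟩ := exists_moves_dominator_eq (G := G) hS
      rw [he]
      by_cases hv' : Legal G' S v
      · exact moves_dominator_le hv' (hend _ v hv)
      · have h := hend .staller v hv
        rw [Set.union_eq_left.2 (not_legal_iff.1 hv')] at h
        exact (moves_dominator_le_staller_add_one v Set.subset_union_left).trans
          (Nat.add_le_add_right h 1)
    | staller =>
      refine moves_staller_le fun v hv => ?_
      have hvG : Legal G S v :=
        let ⟨w, hw, hwS⟩ := hv
        ⟨w, closedNbhd_deleteEdges_subset _ v hw, hwS⟩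
      have h1 := hend .dominator v hvG
      have h2 := le_moves_staller hvG le_rfl
      omega

end DeleteEdge

/-! ### Attaching a path -/

section Tail

variable {V : Type*}

/-- The graph obtained from `G` by identifying an end vertex of a path `P_6` with `x`. The other
five vertices of the path are `inr 0, …, inr 4`, in order of their distance from `x`. -/
def addTail (G : SimpleGraph V) (x : V) : SimpleGraph (V ⊕ Fin 5) where
  Adj
    | .inl a, .inl b => G.Adj a b
    | .inl a, .inr j => a = x ∧ j = 0
    | .inr j, .inl a => a = x ∧ j = 0
    | .inr i, .inr j => (i : ℕ) + 1 = j ∨ (j : ℕ) + 1 = i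
  symm := ⟨by
    rintro (a | i) (b | j) h
    · exact SimpleGraph.Adj.symm h
    · exact h
    · exact h
    · exact h.symm⟩
  loopless := ⟨by
    rintro (a | i) h
    · exact G.loopless.irrefl a h
    · rcases h with h | h <;> omega⟩

/-- The set of vertices of `addTail G x` with part `S` in `G` and part `T` on the path. -/
def tailState (S : Set V) (T : Finset (Fin 5)) : Set (V ⊕ Fin 5) :=
  {w | Sum.elim (· ∈ S) (· ∈ T) w}

/-- The closed neighbourhood of `j` in the path `0, …, 4`. -/
def pathNbhd (j : Fin 5) : Finset (Fin 5) :=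
  Finset.univ.filter fun i => i = j ∨ (j : ℕ) + 1 = i ∨ (i : ℕ) + 1 = j

@[simp] theorem inl_mem_tailState {S : Set V} {T : Finset (Fin 5)} {v : V} :
    Sum.inl v ∈ tailState S T ↔ v ∈ S := Iff.rfl

@[simp] theorem inr_mem_tailState {S : Set V} {T : Finset (Fin 5)} {j : Fin 5} :
    Sum.inr j ∈ tailState S T ↔ j ∈ T := Iff.rfl

theorem tailState_mono {S S' : Set V} {T T' : Finset (Fin 5)} (hS : S ⊆ S') (hT : T ⊆ T') :
    tailState S T ⊆ tailState S' T' := by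
  rintro (v | j) h
  · exact hS h
  · exact hT h

theorem tailState_univ : tailState (Set.univ : Set V) Finset.univ = Set.univ := by
  ext (v | j) <;> simp

theorem tailState_ne_univ {S : Set V} {T : Finset (Fin 5)} (hT : T ≠ Finset.univ) :
    tailState S T ≠ Set.univ := by
  rw [Ne, Finset.eq_univ_iff_forall, not_forall] at hT
  obtain ⟨j, hj⟩ := hT
  exact fun h => hj (h.symm ▸ Set.mem_univ (Sum.inr j) : Sum.inr j ∈ tailState S T)

variable {G : SimpleGraph V} {x : V}

@[simp] theorem inl_mem_closedNbhd_inl {v w : V} :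
    Sum.inl w ∈ closedNbhd (addTail G x) (.inl v) ↔ w ∈ closedNbhd G v := by
  simp [closedNbhd, addTail]

@[simp] theorem inr_mem_closedNbhd_inl {v : V} {j : Fin 5} :
    Sum.inr j ∈ closedNbhd (addTail G x) (.inl v) ↔ v = x ∧ j = 0 := by
  simp [closedNbhd, addTail]

@[simp] theorem inl_mem_closedNbhd_inr {w : V} {j : Fin 5} :
    Sum.inl w ∈ closedNbhd (addTail G x) (.inr j) ↔ w = x ∧ j = 0 := by
  simp [closedNbhd, addTail]

@[simp] theorem inr_mem_closedNbhd_inr {i j : Fin 5} :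
    Sum.inr i ∈ closedNbhd (addTail G x) (.inr j) ↔ i ∈ pathNbhd j := by
  simp [closedNbhd, addTail, pathNbhd]

/-- The set `N[x]` gains only the first vertex of the path. -/
theorem closedNbhd_addTail_inl_self : closedNbhd (addTail G x) (.inl x) =
    tailState (closedNbhd G x) {0} := by
  ext (w | j) <;> simp

theorem tailState_union_inl {S : Set V} {T : Finset (Fin 5)} (hT : 0 ∈ T) (v : V) :
    tailState S T ∪ closedNbhd (addTail G x) (.inl v) = tailState (S ∪ closedNbhd G v) T := by
  ext (w | j)
  · simp
  · simp only [Set.mem_union, inr_mem_tailState, inr_mem_closedNbhd_inl, or_iff_left_iff_imp]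
    rintro ⟨-, rfl⟩
    exact hT

theorem tailState_union_inr {S : Set V} {T : Finset (Fin 5)} (j : Fin 5) (h : j = 0 → x ∈ S) :
    tailState S T ∪ closedNbhd (addTail G x) (.inr j) = tailState S (T ∪ pathNbhd j) := by
  ext (w | i)
  · simp only [Set.mem_union, inl_mem_tailState, inl_mem_closedNbhd_inr, or_iff_left_iff_imp]
    rintro ⟨rfl, hj⟩
    exact h hj
  · simp

theorem tailState_union_inr_zero {S : Set V} {T : Finset (Fin 5)} :
    tailState S T ∪ closedNbhd (addTail G x) (.inr 0) =
      tailState (insert x S) (T ∪ pathNbhd 0) := by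
  ext (w | i)
  · simp [or_comm]
  · simp

theorem legal_inl_iff {S : Set V} {T : Finset (Fin 5)} (hT : 0 ∈ T) {v : V} :
    Legal (addTail G x) (tailState S T) (.inl v) ↔ Legal G S v := by
  constructor
  · rintro ⟨w | j, hw, hS⟩
    · exact ⟨w, by simpa using hw, hS⟩
    · obtain ⟨rfl, rfl⟩ := inr_mem_closedNbhd_inl.1 hw
      exact absurd hT hS
  · rintro ⟨w, hw, hS⟩
    exact ⟨.inl w, by simpa using hw, hS⟩

theorem legal_inr_of_not_subset {S : Set V} {T : Finset (Fin 5)} {j : Fin 5}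
    (h : ¬ pathNbhd j ⊆ T) : Legal (addTail G x) (tailState S T) (.inr j) := by
  obtain ⟨i, hi, hT⟩ := Finset.not_subset.1 h
  exact ⟨.inr i, by simpa using hi, hT⟩

theorem not_subset_of_legal_inr {S : Set V} {T : Finset (Fin 5)} {j : Fin 5}
    (h : Legal (addTail G x) (tailState S T) (.inr j)) (hj : j = 0 → x ∈ S) :
    ¬ pathNbhd j ⊆ T := by
  rintro hsub
  obtain ⟨w | i, hw, hS⟩ := h
  · obtain ⟨rfl, h0⟩ := inl_mem_closedNbhd_inr.1 hw
    exact hS (hj h0)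
  · exact hS (hsub (by simpa using hw))

variable [Finite V]

/-! ### A path adds at least two moves -/

/-- A path that is entirely dominated does not shorten the game. Its first vertex may still serve
Dominator to dominate `x`, but choosing `x` itself is at least as good. -/
theorem moves_le_moves_tailState_univ (P : Player) (S : Set V) :
    moves G P S ≤ moves (addTail G x) P (tailState S Finset.univ) := by
  induction S using game_induction G generalizing P with
  | h S ih =>
    have h0 : (0 : Fin 5) ∈ (Finset.univ : Finset (Fin 5)) := Finset.mem_univ 0
    by_cases hS : S = Set.univ
    · simp [hS, moves_univ]
    cases P with
    | staller =>
      obtain ⟨v, hv, he⟩ := exists_moves_staller_eq (G := G) hS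
      rw [he]
      refine le_moves_staller ((legal_inl_iff h0).2 hv) ?_
      rw [tailState_union_inl h0]
      exact ih v hv _
    | dominator =>
      obtain ⟨n, hn⟩ : ∃ n, moves G .dominator S = n + 1 :=
        Nat.exists_eq_add_of_le' (moves_pos hS)
      rw [hn]
      refine le_moves_dominator (fun h => hS ?_) fun w hw => ?_
      · ext v
        exact ⟨fun _ => trivial, fun _ => (h.symm ▸ Set.mem_univ (Sum.inl v) : Sum.inl v ∈ _)⟩
      rcases w with v | j
      · rw [tailState_union_inl h0]
        have hv := (legal_inl_iff h0).1 hw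
        have h1 := moves_dominator_le hv le_rfl
        have h2 := ih v hv .staller
        omega
      · have hxj : j = 0 ∧ x ∉ S := by
          by_contra hc
          exact not_subset_of_legal_inr hw (by tauto) (Finset.subset_univ _)
        obtain ⟨rfl, hx⟩ := hxj
        have hv : Legal G S x := legal_self hx
        have h1 := moves_dominator_le hv le_rfl
        have h2 := ih x hv .staller
        have h3 : moves (addTail G x) .staller (tailState (S ∪ closedNbhd G x) Finset.univ) ≤
            moves (addTail G x) .staller
              (tailState S Finset.univ ∪ closedNbhd (addTail G x) (.inr 0)) := by
          rw [tailState_union_inr_zero]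
          exact moves_anti _ (tailState_mono
            (Set.insert_subset (Or.inr (mem_closedNbhd_self x)) Set.subset_union_left)
            (Finset.subset_univ _))
        omega

/-- If the middle vertex of the path is the only one not dominated, then the game is not shortened
by having `x` dominated in advance. Staller imitates the game in which `x` is not dominated, and
replaces a move that would dominate `x` only by the last move on the path. When Dominator makes
that move, the effect is worse for Dominator than that of choosing `x`. -/
theorem moves_le_moves_tailState_middle (P : Player) (S : Set V) :
    moves G P S ≤ moves (addTail G x) P (tailState (insert x S) {0, 1, 3, 4}) := by
  induction S using game_induction G generalizing P with
  | h S ih =>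
    have h0 : (0 : Fin 5) ∈ ({0, 1, 3, 4} : Finset (Fin 5)) := by decide
    by_cases hS : S = Set.univ
    · simp [hS, moves_univ]
    cases P with
    | staller =>
      obtain ⟨v, hv, he⟩ := exists_moves_staller_eq (G := G) hS
      rw [he]
      by_cases hvx : Legal G (insert x S) v
      · refine le_moves_staller ((legal_inl_iff h0).2 hvx) ?_
        rw [tailState_union_inl h0, Set.insert_union]
        exact ih v hv _
      · refine le_moves_staller (v := .inr 2) (legal_inr_of_not_subset (by decide)) ?_
        rw [tailState_union_inr 2 fun h => absurd h (by decide),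
          show ({0, 1, 3, 4} : Finset (Fin 5)) ∪ pathNbhd 2 = Finset.univ by decide]
        refine (moves_le_moves_tailState_univ .dominator _).trans
          (moves_anti _ (tailState_mono ?_ subset_rfl))
        -- The only vertex that `v` dominates outside `S` is `x`.
        obtain ⟨w, hw, hwS⟩ := hv
        obtain rfl := (not_legal_iff.1 hvx hw).resolve_right hwS
        exact Set.insert_subset (Or.inr hw) Set.subset_union_left
    | dominator =>
      obtain ⟨n, hn⟩ : ∃ n, moves G .dominator S = n + 1 :=
        Nat.exists_eq_add_of_le' (moves_pos hS)
      rw [hn]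
      refine le_moves_dominator (tailState_ne_univ (by decide)) fun w hw => ?_
      rcases w with v | j
      · rw [tailState_union_inl h0, Set.insert_union]
        have hv := ((legal_inl_iff h0).1 hw).of_subset (Set.subset_insert x S)
        have h1 := moves_dominator_le hv le_rfl
        have h2 := ih v hv .staller
        omega
      · have hj := not_subset_of_legal_inr hw fun _ => Set.mem_insert x S
        rw [tailState_union_inr j fun _ => Set.mem_insert x S,
          show ({0, 1, 3, 4} : Finset (Fin 5)) ∪ pathNbhd j = Finset.univ by
            clear hw; revert j; decide]
        have h1 := moves_le_moves_tailState_univ (G := G) (x := x) .staller (insert x S)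
        have h2 := moves_dominator_le_staller_add_one (G := G) (A := S) (B := insert x S) x
          (Set.insert_subset (Or.inr (mem_closedNbhd_self x)) Set.subset_union_left)
        omega

/-- A path whose first vertex is dominated adds at least two moves. Staller answers each move on the
path so as to complete it, except when Dominator has chosen the first vertex and so has dominated
`x` for free: then Staller leaves one vertex of the path undominated. -/
theorem moves_add_two_le_tailState (P : Player) (S : Set V) :
    moves G P S + 2 ≤ moves (addTail G x) P (tailState S {0}) := by
  induction S using game_induction G generalizing P with
  | h S ih =>
    have h0 : (0 : Fin 5) ∈ ({0} : Finset (Fin 5)) := by decide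
    cases P with
    | staller =>
      by_cases hS : S = Set.univ
      · rw [hS, moves_univ]
        refine le_moves_staller (v := .inr 4) (legal_inr_of_not_subset (by decide)) ?_
        rw [tailState_union_inr 4 fun h => absurd h (by decide)]
        exact moves_pos (tailState_ne_univ (by decide))
      · obtain ⟨v, hv, he⟩ := exists_moves_staller_eq (G := G) hS
        rw [he]
        refine le_moves_staller ((legal_inl_iff h0).2 hv) ?_
        rw [tailState_union_inl h0]
        have := ih v hv .dominator
        omega
    | dominator =>
      refine le_moves_dominator (n := moves G .dominator S + 1)
        (tailState_ne_univ (by decide)) fun w hw => ?_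
      rcases w with v | j
      · rw [tailState_union_inl h0]
        have hv := (legal_inl_iff h0).1 hw
        have h1 := moves_dominator_le hv le_rfl
        have h2 := ih v hv .staller
        omega
      by_cases hj : j = 0
      · subst hj
        rw [tailState_union_inr_zero]
        refine le_moves_staller (v := .inr 4) (legal_inr_of_not_subset (by decide)) ?_
        rw [tailState_union_inr 4 fun h => absurd h (by decide),
          show ({0} : Finset (Fin 5)) ∪ pathNbhd 0 ∪ pathNbhd 4 = {0, 1, 3, 4} by decide]
        exact moves_le_moves_tailState_middle _ S
      · rw [tailState_union_inr j fun h => absurd h hj]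
        obtain ⟨i, hi, hi1, hi2⟩ : ∃ i : Fin 5, i ≠ 0 ∧ ¬ pathNbhd i ⊆ {0} ∪ pathNbhd j ∧
            {0} ∪ pathNbhd j ∪ pathNbhd i = Finset.univ := by
          clear hw; revert j; decide
        refine le_moves_staller (legal_inr_of_not_subset hi1) ?_
        rw [tailState_union_inr i fun h => absurd h hi, hi2]
        exact moves_le_moves_tailState_univ _ S

/-- Attaching a path at the start of the game adds at least two moves. -/
theorem moves_add_two_le_addTail (P : Player) :
    moves G P ∅ + 2 ≤ moves (addTail G x) P ∅ :=
  (moves_add_two_le_tailState P ∅).trans (moves_anti P (Set.empty_subset _))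

/-! ### A path adds at most two moves once `x` is chosen -/

theorem moves_tailState_univ_le (P : Player) {S : Set V} (hx : x ∈ S) :
    moves (addTail G x) P (tailState S Finset.univ) ≤ moves G P S := by
  have h0 : (0 : Fin 5) ∈ (Finset.univ : Finset (Fin 5)) := Finset.mem_univ 0
  induction S using game_induction G generalizing P with
  | h S ih =>
    by_cases hS : S = Set.univ
    · simp [hS, tailState_univ, moves_univ]
    cases P with
    | dominator =>
      obtain ⟨v, hv, he⟩ := exists_moves_dominator_eq (G := G) hS
      rw [he]
      refine moves_dominator_le ((legal_inl_iff h0).2 hv) ?_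
      rw [tailState_union_inl h0]
      exact ih v hv _ (Or.inl hx)
    | staller =>
      obtain ⟨n, hn⟩ : ∃ n, moves G .staller S = n + 1 :=
        Nat.exists_eq_add_of_le' (moves_pos hS)
      rw [hn]
      refine moves_staller_le fun w hw => ?_
      rcases w with v | j
      · rw [tailState_union_inl h0]
        have hv := (legal_inl_iff h0).1 hw
        have h1 := le_moves_staller hv le_rfl
        have h2 := ih v hv .dominator (Or.inl hx)
        omega
      · exact absurd (Finset.subset_univ _) (not_subset_of_legal_inr hw fun _ => hx)

/-- Once `x` and the first vertex of the path are dominated, the path adds at most two moves: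
Dominator answers each move of Staller on the path by completing it, and if forced to move there
first, leaves one undominated vertex. -/
theorem moves_tailState_le_add_two (P : Player) {S : Set V} (hx : x ∈ S) :
    moves (addTail G x) P (tailState S {0}) ≤ moves G P S + 2 := by
  have h0 : (0 : Fin 5) ∈ ({0} : Finset (Fin 5)) := by decide
  induction S using game_induction G generalizing P with
  | h S ih =>
    cases P with
    | dominator =>
      by_cases hS : S = Set.univ
      · rw [hS, moves_univ]
        refine moves_dominator_le (v := .inr 2) (legal_inr_of_not_subset (by decide)) ?_
        rw [tailState_union_inr 2 fun h => absurd h (by decide)]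
        refine moves_le_one_of_compl_subset (.inr 4) ?_
        rintro (v | j) hw
        · exact absurd (Set.mem_univ v) hw
        · rw [inr_mem_tailState] at hw
          have : j = 4 := by revert hw; revert j; decide
          rw [this]
      · obtain ⟨v, hv, he⟩ := exists_moves_dominator_eq (G := G) hS
        rw [he]
        refine moves_dominator_le ((legal_inl_iff h0).2 hv) ?_
        rw [tailState_union_inl h0]
        have := ih v hv .staller (Or.inl hx)
        omega
    | staller =>
      refine moves_staller_le (n := moves G .staller S + 1) fun w hw => ?_
      rcases w with v | j
      · rw [tailState_union_inl h0]
        have hv := (legal_inl_iff h0).1 hw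
        have h1 := le_moves_staller hv le_rfl
        have h2 := ih v hv .dominator (Or.inl hx)
        omega
      · rw [tailState_union_inr j fun _ => hx]
        obtain ⟨i, hi1, hi2⟩ : ∃ i : Fin 5, ¬ pathNbhd i ⊆ {0} ∪ pathNbhd j ∧
            {0} ∪ pathNbhd j ∪ pathNbhd i = Finset.univ := by
          clear hw; revert j; decide
        refine moves_dominator_le (legal_inr_of_not_subset hi1) ?_
        rw [tailState_union_inr i fun _ => hx, hi2]
        exact moves_tailState_univ_le _ hx

/-- Attaching a path adds at most two moves to the game that starts with the choice of `x`. -/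
theorem moves_addTail_closedNbhd_le (P : Player) :
    moves (addTail G x) P (closedNbhd (addTail G x) (.inl x)) ≤
      moves G P (closedNbhd G x) + 2 := by
  rw [closedNbhd_addTail_inl_self]
  exact moves_tailState_le_add_two P (mem_closedNbhd_self x)

end Tail

/-! ### Small game domination numbers -/

section SmallNumbers

variable {V : Type*} [Finite V] {G : SimpleGraph V}

theorem eq_univ_of_moves_eq_zero {P : Player} {S : Set V} (h : moves G P S = 0) :
    S = Set.univ := by
  by_contra hS
  have := moves_pos (G := G) (P := P) hS
  omega

theorem exists_moves_closedNbhd_eq {n : ℕ} (h : gameDominationNumber G = n + 1) :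
    ∃ v, moves G .staller (closedNbhd G v) = n := by
  have hne : (∅ : Set V) ≠ Set.univ := fun h0 => by
    rw [gameDominationNumber, h0, moves_univ] at h
    omega
  obtain ⟨v, -, he⟩ := exists_moves_dominator_eq (G := G) hne
  rw [Set.empty_union] at he
  rw [gameDominationNumber] at h
  exact ⟨v, by omega⟩

theorem gameDominationNumber_le {n : ℕ} (v : V) (h : moves G .staller (closedNbhd G v) ≤ n) :
    gameDominationNumber G ≤ n + 1 :=
  moves_dominator_le (legal_self (Set.notMem_empty v)) (by rwa [Set.empty_union])

theorem gameDominationNumber_deleteEdges_le_two (e : Sym2 V) (h : gameDominationNumber G = 1) :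
    gameDominationNumber (G.deleteEdges {e}) ≤ 2 := by
  classical
  induction e using Sym2.ind with
  | _ a b =>
  obtain ⟨v, hv⟩ := exists_moves_closedNbhd_eq h
  have huniv := eq_univ_of_moves_eq_zero hv
  refine gameDominationNumber_le v
    (moves_le_one_of_compl_subset (if v = a then b else a) fun w hw => ?_)
  rcases eq_of_mem_closedNbhd_of_notMem (huniv ▸ Set.mem_univ w) hw with ⟨rfl, rfl⟩ | ⟨rfl, rfl⟩
  · simp
  · split_ifs with h'
    · exact h'.symm
    · rfl

/-- If two moves suffice, then after a suitable first move `v` every vertex that dominates one of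
the remaining vertices dominates all of them. After the removal of an edge Dominator starts with
the same `v`. Either the answer of Staller is of this kind, and leaves at most one vertex because of
the missing edge; or it dominates only the vertex that `v` has lost, and then Dominator can
complete the game. -/
theorem gameDominationNumber_deleteEdges_le_three (e : Sym2 V) (h : gameDominationNumber G = 2) :
    gameDominationNumber (G.deleteEdges {e}) ≤ 3 := by
  classical
  induction e using Sym2.ind with
  | _ a b =>
  obtain ⟨v, hv⟩ := exists_moves_closedNbhd_eq h
  have hcover : ∀ w, Legal G (closedNbhd G v) w → closedNbhd G v ∪ closedNbhd G w = Set.univ :=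
    fun w hw => eq_univ_of_moves_eq_zero (P := .dominator) (G := G) <| by
      have := le_moves_staller hw le_rfl
      omega
  refine gameDominationNumber_le v (moves_staller_le fun w hw => ?_)
  set G' := G.deleteEdges {s(a, b)} with hG'
  have hself : ∀ y, y ∈ closedNbhd G' y := mem_closedNbhd_self
  by_cases hwG : Legal G (closedNbhd G v) w
  · refine moves_le_one_of_compl_subset (if v = a ∨ v ≠ b ∧ w = a then b else a) fun r hr => ?_
    rw [Set.mem_union, not_or] at hr
    have hrv : r ≠ v := fun h => hr.1 (h ▸ hself v)
    have hrw : r ≠ w := fun h => hr.2 (h ▸ hself w)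
    rcases (hcover w hwG ▸ Set.mem_univ r : r ∈ closedNbhd G v ∪ closedNbhd G w) with h1 | h1
    · have := eq_of_mem_closedNbhd_of_notMem h1 hr.1
      grind
    · have := eq_of_mem_closedNbhd_of_notMem h1 hr.2
      grind
  · obtain ⟨c, hcw, hcv⟩ := hw
    have hc := eq_of_mem_closedNbhd_of_notMem
      (not_legal_iff.1 hwG (closedNbhd_deleteEdges_subset _ w hcw)) hcv
    have hrest : ∀ r, r ∉ closedNbhd G' v ∪ closedNbhd G' w →
        r ∉ closedNbhd G v ∧ r ≠ v ∧ r ≠ c := fun r hr => by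
      rw [Set.mem_union, not_or] at hr
      have hrc : r ≠ c := fun h => hr.2 (h ▸ hcw)
      have hrv : r ≠ v := fun h => hr.1 (h ▸ hself v)
      refine ⟨fun h1 => ?_, hrv, hrc⟩
      have := eq_of_mem_closedNbhd_of_notMem h1 hr.1
      grind
    refine moves_le_one fun y hy => Set.eq_univ_of_forall fun r => ?_
    obtain ⟨q, hqy, hq⟩ := hy
    by_contra hr
    rw [Set.mem_union, not_or] at hr
    obtain ⟨hr1, hr2, hr3⟩ := hrest r hr.1
    have hry := (hcover y ⟨q, closedNbhd_deleteEdges_subset _ y hqy, (hrest q hq).1⟩ ▸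
      Set.mem_univ r : r ∈ closedNbhd G v ∪ closedNbhd G y).resolve_left hr1
    have := eq_of_mem_closedNbhd_of_notMem hry hr.2
    grind

end SmallNumbers

/-! ### Isomorphic graphs and connectedness -/

section Iso

variable {V V' : Type*} {G : SimpleGraph V} {G' : SimpleGraph V'}

theorem preimage_closedNbhd (φ : G ≃g G') (v : V) :
    φ ⁻¹' closedNbhd G' (φ v) = closedNbhd G v := by
  ext w
  simp [closedNbhd, φ.map_adj_iff]

theorem legal_preimage_iff (φ : G ≃g G') {S : Set V'} {v : V} :
    Legal G (φ ⁻¹' S) v ↔ Legal G' S (φ v) := by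
  rw [← not_iff_not, not_legal_iff, not_legal_iff, ← preimage_closedNbhd φ,
    Set.preimage_subset_preimage_iff (by simp [φ.surjective.range_eq])]

variable [Finite V] [Finite V']

theorem moves_preimage_le (φ : G ≃g G') (P : Player) (S : Set V') :
    moves G P (φ ⁻¹' S) ≤ moves G' P S := by
  induction S using game_induction G' generalizing P with
  | h S ih =>
    by_cases hS : S = Set.univ
    · simp [hS, moves_univ]
    cases P with
    | dominator =>
      obtain ⟨w, hw, he⟩ := exists_moves_dominator_eq (G := G') hS
      obtain ⟨v, rfl⟩ := φ.surjective w
      rw [he]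
      refine moves_dominator_le ((legal_preimage_iff φ).2 hw) ?_
      rw [← preimage_closedNbhd φ]
      exact ih _ hw _
    | staller =>
      obtain ⟨n, hn⟩ : ∃ n, moves G' .staller S = n + 1 :=
        Nat.exists_eq_add_of_le' (moves_pos hS)
      rw [hn]
      refine moves_staller_le fun v hv => ?_
      have hw := (legal_preimage_iff φ).1 hv
      have h1 := ih _ hw .dominator
      have h2 := le_moves_staller hw le_rfl
      rw [Set.preimage_union, preimage_closedNbhd φ] at h1
      omega

theorem moves_preimage (φ : G ≃g G') (P : Player) (S : Set V') :
    moves G P (φ ⁻¹' S) = moves G' P S := by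
  refine (moves_preimage_le φ P S).antisymm ?_
  have := moves_preimage_le φ.symm P (φ ⁻¹' S)
  rwa [← Set.preimage_comp, show φ ∘ φ.symm = id from funext φ.apply_symm_apply] at this

theorem gameDominationNumber_congr (φ : G ≃g G') :
    gameDominationNumber G = gameDominationNumber G' :=
  moves_preimage φ .dominator ∅

end Iso

/-- An isomorphism remains one when corresponding edges are removed. -/
def deleteEdgeIso {V V' : Type*} {G : SimpleGraph V} {G' : SimpleGraph V'} (φ : G ≃g G')
    (e : Sym2 V) : G.deleteEdges {e} ≃g G'.deleteEdges {e.map φ} where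
  toEquiv := φ.toEquiv
  map_rel_iff' {v w} := by
    have h : s(φ v, φ w) = Sym2.map φ e ↔ s(v, w) = e := by
      rw [← Sym2.map_mk]
      exact (Sym2.map.injective φ.injective).eq_iff
    simp only [SimpleGraph.deleteEdges_adj, Set.mem_singleton_iff]
    exact and_congr φ.map_adj_iff (not_congr h)

/-- A graph is connected if from every vertex except the root one can step to a neighbour of smaller
height. -/
theorem connected_of_height {V : Type*} {G : SimpleGraph V} (r : V) (f : V → ℕ)
    (h : ∀ v, v ≠ r → ∃ w, G.Adj v w ∧ f w < f v) : G.Connected := by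
  have hr : ∀ v, G.Reachable v r := fun v => by
    induction hn : f v using Nat.strong_induction_on generalizing v with
    | _ n ih =>
      by_cases hv : v = r
      · rw [hv]
      · obtain ⟨w, hw, hlt⟩ := h v hv
        exact hw.reachable.trans (ih _ (hn ▸ hlt) w rfl)
  exact (SimpleGraph.connected_iff _).2 ⟨fun v w => (hr v).trans (hr w).symm, ⟨r⟩⟩

theorem connected_addTail {V : Type*} {G : SimpleGraph V} {x : V} (h : G.Connected) :
    (addTail G x).Connected := by
  have hinl : ∀ v w, G.Reachable v w → (addTail G x).Reachable (.inl v) (.inl w) := fun v w hvw =>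
    hvw.map ⟨Sum.inl, fun h => h⟩
  have hinr : ∀ (n : ℕ) (hn : n < 5), (addTail G x).Reachable (.inr ⟨n, hn⟩) (.inl x) := by
    intro n
    induction n with
    | zero =>
      intro hn
      exact SimpleGraph.Adj.reachable (show x = x ∧ (⟨0, hn⟩ : Fin 5) = 0 from ⟨rfl, rfl⟩)
    | succ n ih =>
      intro hn
      have hadj : (addTail G x).Adj (.inr ⟨n + 1, hn⟩) (.inr ⟨n, by omega⟩) := Or.inr rfl
      exact hadj.reachable.trans (ih _)
  have hx : ∀ w, (addTail G x).Reachable w (.inl x) := by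
    rintro (v | ⟨n, hn⟩)
    · exact hinl v x (h.preconnected v x)
    · exact hinr n hn
  exact (SimpleGraph.connected_iff _).2 ⟨fun v w => (hx v).trans (hx w).symm, ⟨.inl x⟩⟩

/-! ### The graphs with one more path -/

section Attach

variable {W : Type*} (H : SimpleGraph W) (u : W)

/-- The graph `attach H u k` without the edges from the centre `x` to the vertices of `B` with an
index in `D`. -/
def attachWithout (k : ℕ) (D : Finset (Fin 5)) : SimpleGraph (Vertex W k) :=
  (attach H u k).deleteEdges {e | ∃ b ∈ D, e = s(starVertex 0, starVertex b)}

theorem attachWithout_empty (k : ℕ) : attachWithout H u k ∅ = attach H u k := by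
  simp [attachWithout]

theorem attachWithout_singleton (k : ℕ) (b : Fin 5) :
    attachWithout H u k {b} = (attach H u k).deleteEdges {s(starVertex 0, starVertex b)} := by
  simp [attachWithout]

theorem attachWithout_adj {k : ℕ} {D : Finset (Fin 5)} {v w : Vertex W k} :
    (attachWithout H u k D).Adj v w ↔ (v ≠ w ∧ (AttachRel H u k v w ∨ AttachRel H u k w v)) ∧
      ¬ ∃ b ∈ D, s(v, w) = s(starVertex 0, starVertex b) := by
  rw [attachWithout, SimpleGraph.deleteEdges_adj, attach, SimpleGraph.fromRel_adj]
  rfl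

/-- The vertices of a graph with `k` paths and of one further path, as vertices of the graph with
`k + 1` paths. -/
def snocPath (k : ℕ) : Vertex W k ⊕ Fin 5 → Vertex W (k + 1)
  | .inl (.inl a) => .inl a
  | .inl (.inr (.inl b)) => .inr (.inl b)
  | .inl (.inr (.inr (i, j))) => .inr (.inr (i.castSucc, j))
  | .inr j => .inr (.inr (Fin.last k, j))

theorem snocPath_bijective (k : ℕ) : Function.Bijective (snocPath (W := W) k) := by
  constructor
  · rintro ((a | b | ⟨i, j⟩) | j) ((a' | b' | ⟨i', j'⟩) | j') h <;>
      simp_all [snocPath, Fin.castSucc_ne_last, (Fin.castSucc_ne_last _).symm]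
  · rintro (a | b | ⟨i, j⟩)
    · exact ⟨.inl (.inl a), rfl⟩
    · exact ⟨.inl (.inr (.inl b)), rfl⟩
    · induction i using Fin.lastCases with
      | last => exact ⟨.inr j, rfl⟩
      | cast i => exact ⟨.inl (.inr (.inr (i, j))), rfl⟩

/-- The graph with `k + 1` paths arises from the graph with `k` paths by attaching a path. -/
noncomputable def attachIso (k : ℕ) (D : Finset (Fin 5)) :
    addTail (attachWithout H u k D) (starVertex 0) ≃g attachWithout H u (k + 1) D where
  toEquiv := Equiv.ofBijective _ (snocPath_bijective k)
  map_rel_iff' {v w} := by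
    simp only [Equiv.ofBijective_apply, attachWithout_adj]
    rcases v with (a | b | ⟨i, j⟩) | j <;> rcases w with (a' | b' | ⟨i', j'⟩) | j' <;>
      simp [snocPath, addTail, attachWithout_adj, AttachRel, Fin.castSucc_ne_last,
        (Fin.castSucc_ne_last _).symm]
    all_goals grind

theorem connected_attachWithout {D : Finset (Fin 5)} (h : (attachWithout H u 0 D).Connected)
    (k : ℕ) : (attachWithout H u k D).Connected := by
  induction k with
  | zero => exact h
  | succ k ih => exact (attachIso H u k D).connected_iff.1 (connected_addTail ih)

variable [Finite W]

/-- Each path adds at least two moves. -/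
theorem le_gameDominationNumber_attachWithout (k : ℕ) (D : Finset (Fin 5)) :
    2 * k + gameDominationNumber (attachWithout H u 0 D) ≤
      gameDominationNumber (attachWithout H u k D) := by
  induction k with
  | zero => simp
  | succ k ih =>
    have h1 := gameDominationNumber_congr (attachIso H u k D)
    have h2 := moves_add_two_le_addTail (G := attachWithout H u k D) (x := starVertex 0) .dominator
    simp only [gameDominationNumber] at *
    omega

/-- Each path adds at most two moves to the game that starts with the choice of the centre. -/
theorem moves_attachWithout_centre_le (k : ℕ) (D : Finset (Fin 5)) :
    moves (attachWithout H u k D) .staller (closedNbhd (attachWithout H u k D) (starVertex 0)) ≤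
      2 * k + moves (attachWithout H u 0 D) .staller
        (closedNbhd (attachWithout H u 0 D) (starVertex 0)) := by
  induction k with
  | zero => simp
  | succ k ih =>
    have h1 := moves_preimage (attachIso H u k D) .staller
      (closedNbhd (attachWithout H u (k + 1) D) (attachIso H u k D (.inl (starVertex 0))))
    rw [preimage_closedNbhd] at h1
    have h2 := moves_addTail_closedNbhd_le (G := attachWithout H u k D) (x := starVertex 0) .staller
    change _ = moves _ _ (closedNbhd (attachWithout H u (k + 1) D) (starVertex 0)) at h1
    omega

end Attach

/-! ### Evaluating small games -/

/-- Whether the game lasts at least `n` more moves, for a game given by binary numbers: `m` encodes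
the set of dominated vertices, and the entries of `L` the closed neighbourhoods of the vertices. -/
def lastsAtLeast (L : List ℕ) : ℕ → Player → ℕ → Bool
  | 0, _, _ => true
  | n + 1, .dominator, m =>
      L.any (fun a => a ||| m != m) &&
        L.all fun a => a ||| m == m || lastsAtLeast L n .staller (a ||| m)
  | n + 1, .staller, m => L.any fun a => a ||| m != m && lastsAtLeast L n .dominator (a ||| m)

/-- An encoding of the closed neighbourhoods of a graph by binary numbers: the digit with index
`code w` of `L[code v]` is `1` if and only if `v` dominates `w`. -/
structure Encodes {V : Type*} (G : SimpleGraph V) (n : ℕ) (L : List ℕ) (code : V → Fin n) :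
    Prop where
  surjective : Function.Surjective code
  length_eq : L.length = n
  lt : ∀ a ∈ L, a < 2 ^ n
  testBit : ∀ v w, (L.getD (code v) 0).testBit (code w) = true ↔ w = v ∨ G.Adj v w

section Encodes

variable {V : Type*} {G : SimpleGraph V} {n : ℕ} {L : List ℕ} {code : V → Fin n}

theorem Encodes.mem_iff (h : Encodes G n L code) {a : ℕ} :
    a ∈ L ↔ ∃ v, L.getD (code v) 0 = a := by
  obtain ⟨hs, rfl, -, -⟩ := h
  rw [List.mem_iff_get]
  constructor
  · rintro ⟨i, rfl⟩
    obtain ⟨v, rfl⟩ := hs i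
    exact ⟨v, by simp⟩
  · rintro ⟨v, rfl⟩
    exact ⟨code v, by simp⟩

theorem Encodes.union (h : Encodes G n L code) {S : Set V} {m : ℕ}
    (hm : ∀ w, m.testBit (code w) = true ↔ w ∈ S) (v w : V) :
    (L.getD (code v) 0 ||| m).testBit (code w) = true ↔ w ∈ S ∪ closedNbhd G v := by
  rw [Nat.testBit_or, Bool.or_eq_true, h.testBit, hm, or_comm]
  rfl

theorem Encodes.legal_iff (h : Encodes G n L code) {S : Set V} {m : ℕ}
    (hm : ∀ w, m.testBit (code w) = true ↔ w ∈ S) (v : V) :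
    Legal G S v ↔ L.getD (code v) 0 ||| m ≠ m := by
  rw [legal_iff_union_ne, not_iff_not]
  constructor
  · intro hS
    refine Nat.eq_of_testBit_eq fun i => ?_
    by_cases hi : i < n
    · obtain ⟨w, hw⟩ := h.surjective ⟨i, hi⟩
      have h1 := h.union hm v w
      rw [hS, ← hm w, hw] at h1
      exact Bool.eq_iff_iff.2 h1
    · have h0 : (L.getD (code v) 0).testBit i = false :=
        Nat.testBit_lt_two_pow ((h.lt _ (h.mem_iff.2 ⟨v, rfl⟩)).trans_le
          (Nat.pow_le_pow_right (by norm_num) (not_lt.1 hi)))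
      rw [Nat.testBit_or, h0, Bool.false_or]
  · intro hS
    ext w
    rw [← h.union hm v w, hS, hm w]

variable [Finite V]

theorem Encodes.lastsAtLeast_iff (h : Encodes G n L code) (t : ℕ) (P : Player) {S : Set V} {m : ℕ}
    (hm : ∀ w, m.testBit (code w) = true ↔ w ∈ S) :
    lastsAtLeast L t P m = true ↔ t ≤ moves G P S := by
  induction t generalizing P S m with
  | zero => simp [lastsAtLeast]
  | succ t ih =>
    have hex : (∃ v, Legal G S v) ↔ ∃ a ∈ L, a ||| m ≠ m := by
      simp only [h.legal_iff hm, h.mem_iff]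
      grind
    cases P with
    | dominator =>
      have hrw : lastsAtLeast L (t + 1) .dominator m = true ↔ S ≠ Set.univ ∧
          ∀ v, Legal G S v → t ≤ moves G .staller (S ∪ closedNbhd G v) := by
        rw [← exists_legal_iff (G := G), hex]
        simp only [lastsAtLeast, Bool.and_eq_true, List.any_eq_true, List.all_eq_true,
          Bool.or_eq_true, beq_iff_eq, bne_iff_ne, h.mem_iff, h.legal_iff hm,
          ← ih .staller (h.union hm _)]
        grind
      rw [hrw]
      constructor
      · exact fun ⟨h1, h2⟩ => le_moves_dominator h1 h2
      · refine fun ht => ⟨fun hS => by rw [hS, moves_univ] at ht; omega, fun v hv => ?_⟩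
        have := moves_dominator_le hv le_rfl
        omega
    | staller =>
      have hrw : lastsAtLeast L (t + 1) .staller m = true ↔
          ∃ v, Legal G S v ∧ t ≤ moves G .dominator (S ∪ closedNbhd G v) := by
        simp only [lastsAtLeast, Bool.and_eq_true, List.any_eq_true, bne_iff_ne, h.mem_iff,
          h.legal_iff hm, ← ih .dominator (h.union hm _)]
        grind
      rw [hrw]
      constructor
      · exact fun ⟨v, h1, h2⟩ => le_moves_staller h1 h2
      · intro ht
        obtain ⟨v, hv, he⟩ := exists_moves_staller_eq (G := G) (S := S)
          fun hS => by rw [hS, moves_univ] at ht; omega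
        exact ⟨v, hv, by omega⟩

theorem Encodes.le_gameDominationNumber (h : Encodes G n L code) (t : ℕ)
    (ht : lastsAtLeast L t .dominator 0 = true) : t ≤ gameDominationNumber G :=
  (h.lastsAtLeast_iff t .dominator (S := ∅) (by simp)).1 ht

theorem Encodes.moves_closedNbhd_le (h : Encodes G n L code) (v : V) (t : ℕ)
    (ht : lastsAtLeast L (t + 1) .staller (L.getD (code v) 0) = false) :
    moves G .staller (closedNbhd G v) ≤ t := by
  by_contra! hc
  have := (h.lastsAtLeast_iff (t + 1) .staller (h.testBit v)).2 hc
  rw [ht] at this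
  exact absurd this (by decide)

end Encodes

/-! ### The graphs without paths -/

instance {W : Type*} [DecidableEq W] (H : SimpleGraph W) [DecidableRel H.Adj] (u : W) (k : ℕ) :
    DecidableRel (AttachRel H u k)
  | .inl a, .inl b => inferInstanceAs (Decidable (H.Adj a b))
  | .inl a, .inr (.inl b) => inferInstanceAs (Decidable (a = u ∧ b = 0))
  | .inl _, .inr (.inr _) => inferInstanceAs (Decidable False)
  | .inr (.inl a), .inr (.inl b) => inferInstanceAs (Decidable (a = 0 ∨ (a = 3 ∧ b = 4)))
  | .inr (.inl a), .inr (.inr (_, j)) => inferInstanceAs (Decidable (a = 0 ∧ j = 0))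
  | .inr (.inr (i, j)), .inr (.inr (i', j')) =>
      inferInstanceAs (Decidable (i = i' ∧ (j : ℕ) + 1 = j'))
  | .inr (.inl _), .inl _ => inferInstanceAs (Decidable False)
  | .inr (.inr _), .inl _ => inferInstanceAs (Decidable False)
  | .inr (.inr _), .inr (.inl _) => inferInstanceAs (Decidable False)

instance {W : Type*} [DecidableEq W] (H : SimpleGraph W) [DecidableRel H.Adj] (u : W) (k : ℕ)
    (D : Finset (Fin 5)) : DecidableRel (attachWithout H u k D).Adj := fun _ _ =>
  decidable_of_iff' _ (attachWithout_adj H u)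

instance : DecidableRel graphZ.Adj := fun a b =>
  decidable_of_iff' (s(a, b) ∈ ([s(0, 1), s(1, 2), s(2, 3), s(3, 8), s(8, 7), s(7, 6), s(6, 5),
    s(5, 0), s(6, 1), s(7, 4), s(4, 3), s(4, 8), s(2, 7)] : List (Sym2 (Fin 9))) ∧ a ≠ b) <| by
    rw [graphZ, SimpleGraph.fromEdgeSet_adj]
    simp only [Set.mem_insert_iff, Set.mem_singleton_iff, List.mem_cons, List.not_mem_nil, or_false]

instance : DecidableRel (SimpleGraph.cycleGraph 6).Adj := fun a b =>
  decidable_of_iff' (a - b = 1 ∨ b - a = 1) SimpleGraph.cycleGraph_adj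

/-- The positions of the vertices of a graph without paths in its encoding. The core is
permuted by `τ`, and is followed by the vertices of `B`, permuted by `σ`. -/
def position {n : ℕ} (τ : Fin n → Fin n) (σ : Fin 5 → Fin 5) : Vertex (Fin n) 0 → Fin (n + 5)
  | .inl a => (τ a).castAdd 5
  | .inr (.inl b) => (σ b).natAdd n
  | .inr (.inr (i, _)) => i.elim0

/-- The 6-cycle is numbered starting from `u`, so that one list serves all choices of `u`. -/
theorem encodes_graphU (u : Fin 6) :
    Encodes (attachWithout (SimpleGraph.cycleGraph 6) u 0 ∅) 11
      [99, 7, 14, 28, 56, 49, 1985, 192, 320, 1600, 1600] (position (· - u) id) where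
  surjective := by revert u; decide +kernel
  length_eq := rfl
  lt := by decide
  testBit := by revert u; decide +kernel

/-- The vertices `3` and `b` of `B` are exchanged, so that one list serves both removed edges. -/
theorem encodes_graphU_without (u : Fin 6) {b : Fin 5} (hb : b = 3 ∨ b = 4) :
    Encodes (attachWithout (SimpleGraph.cycleGraph 6) u 0 {b}) 11
      [99, 7, 14, 28, 56, 49, 1473, 192, 320, 1536, 1600]
      (position (· - u) (Equiv.swap 3 b)) where
  surjective := by revert u b; decide +kernel
  length_eq := rfl
  lt := by decide
  testBit := by revert u b; decide +kernel

theorem encodes_graphV :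
    Encodes (attachWithout graphZ 8 0 ∅) 14
      [35, 71, 142, 284, 408, 97, 226, 468, 920, 16128, 1536, 2560, 12800, 12800]
      (position id id) where
  surjective := by decide +kernel
  length_eq := rfl
  lt := by decide
  testBit := by decide +kernel

theorem encodes_graphV_without {b : Fin 5} (hb : b = 3 ∨ b = 4) :
    Encodes (attachWithout graphZ 8 0 {b}) 14
      [35, 71, 142, 284, 408, 97, 226, 468, 920, 12032, 1536, 2560, 12288, 12800]
      (position id (Equiv.swap 3 b)) where
  surjective := by revert b; decide +kernel
  length_eq := rfl
  lt := by decide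
  testBit := by revert b; decide +kernel

theorem moves_graphU_le (u : Fin 6) :
    moves (attachWithout (SimpleGraph.cycleGraph 6) u 0 ∅) .staller
      (closedNbhd (attachWithout (SimpleGraph.cycleGraph 6) u 0 ∅) (starVertex 0)) ≤ 2 :=
  (encodes_graphU u).moves_closedNbhd_le _ 2 (by revert u; decide +kernel)

theorem le_gameDominationNumber_graphU_without (u : Fin 6) {b : Fin 5} (hb : b = 3 ∨ b = 4) :
    5 ≤ gameDominationNumber (attachWithout (SimpleGraph.cycleGraph 6) u 0 {b}) :=
  (encodes_graphU_without u hb).le_gameDominationNumber 5 (by decide +kernel)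

theorem moves_graphV_le :
    moves (attachWithout graphZ 8 0 ∅) .staller
      (closedNbhd (attachWithout graphZ 8 0 ∅) (starVertex 0)) ≤ 3 :=
  encodes_graphV.moves_closedNbhd_le _ 3 (by decide +kernel)

theorem le_gameDominationNumber_graphV_without {b : Fin 5} (hb : b = 3 ∨ b = 4) :
    6 ≤ gameDominationNumber (attachWithout graphZ 8 0 {b}) :=
  (encodes_graphV_without hb).le_gameDominationNumber 6 (by decide +kernel)

/-! ### The graphs with paths -/

-- The heights are the distances from the centre.
theorem connected_graphU_without (u : Fin 6) {b : Fin 5} (hb : b = 3 ∨ b = 4) :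
    (attachWithout (SimpleGraph.cycleGraph 6) u 0 {b}).Connected :=
  connected_of_height (starVertex 0)
    (fun v => match v with
      | .inl a => min (a - u : Fin 6).val (u - a : Fin 6).val + 1
      | .inr (.inl c) => if c = 0 then 0 else if c = b then 2 else 1
      | .inr (.inr _) => 0) (by revert u b; decide +kernel)

theorem connected_graphV_without {b : Fin 5} (hb : b = 3 ∨ b = 4) :
    (attachWithout graphZ 8 0 {b}).Connected :=
  connected_of_height (starVertex 0)
    (fun v => match v with
      | .inl a => (![5, 4, 3, 2, 2, 4, 3, 2, 1] : Fin 9 → ℕ) a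
      | .inr (.inl c) => if c = 0 then 0 else if c = b then 2 else 1
      | .inr (.inr _) => 0) (by revert b; decide +kernel)

/-- Two bounds for the graph without paths determine the game domination numbers for every number
of paths. Dominator's choice of the centre as the first move gives an upper bound for the whole
graph, and there is a lower bound for the graph without the edge. These are `2` apart, and the
removal of an edge adds at most `2`, so both are attained. -/
theorem attach_deleteEdges {W : Type*} [Finite W] (H : SimpleGraph W) (u : W) (c : ℕ)
    (hconn : ∀ b : Fin 5, b = 3 ∨ b = 4 → (attachWithout H u 0 {b}).Connected)
    (hle : moves (attachWithout H u 0 ∅) .staller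
      (closedNbhd (attachWithout H u 0 ∅) (starVertex 0)) ≤ c)
    (hge : ∀ b : Fin 5, b = 3 ∨ b = 4 → c + 3 ≤ gameDominationNumber (attachWithout H u 0 {b}))
    (k : ℕ) :
    (attach H u k).Connected ∧ gameDominationNumber (attach H u k) = 2 * k + (c + 1) ∧
      ∀ e : Sym2 (Vertex W k),
        e = s(starVertex 0, starVertex 3) ∨ e = s(starVertex 0, starVertex 4) →
        e ∈ (attach H u k).edgeSet ∧ ((attach H u k).deleteEdges {e}).Connected ∧
          gameDominationNumber ((attach H u k).deleteEdges {e}) = 2 * k + (c + 3) := by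
  have hupper : gameDominationNumber (attach H u k) ≤ 2 * k + (c + 1) := by
    have := moves_attachWithout_centre_le H u k ∅
    rw [← attachWithout_empty]
    exact gameDominationNumber_le (n := 2 * k + c) (starVertex 0) (by omega)
  have hdel : ∀ b : Fin 5, b = 3 ∨ b = 4 →
      s(starVertex 0, starVertex b) ∈ (attach H u k).edgeSet ∧
      ((attach H u k).deleteEdges {s(starVertex 0, starVertex b)}).Connected ∧
      2 * k + (c + 3) ≤
        gameDominationNumber ((attach H u k).deleteEdges {s(starVertex 0, starVertex b)}) ∧
      gameDominationNumber ((attach H u k).deleteEdges {s(starVertex 0, starVertex b)}) ≤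
        gameDominationNumber (attach H u k) + 2 := by
    intro b hb
    refine ⟨?_, ?_, ?_, moves_deleteEdges_le _ _ _ _⟩
    · rw [SimpleGraph.mem_edgeSet, attach, SimpleGraph.fromRel_adj]
      refine ⟨fun h => ?_, Or.inl (Or.inl rfl)⟩
      have h0 : (0 : Fin 5) = b := by simpa using h
      rcases hb with rfl | rfl <;> exact absurd h0 (by decide)
    · rw [← attachWithout_singleton]
      exact connected_attachWithout H u (hconn b hb) k
    · have := le_gameDominationNumber_attachWithout H u k {b}
      have := hge b hb
      rw [← attachWithout_singleton]
      omega
  obtain ⟨-, h3c, h3, h3'⟩ := hdel 3 (Or.inl rfl)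
  refine ⟨h3c.mono ((attach H u k).deleteEdges_le _), by omega, ?_⟩
  rintro e (rfl | rfl)
  · obtain ⟨h1, h2, h4, h5⟩ := hdel 3 (Or.inl rfl)
    exact ⟨h1, h2, by omega⟩
  · obtain ⟨h1, h2, h4, h5⟩ := hdel 4 (Or.inr rfl)
    exact ⟨h1, h2, by omega⟩

theorem graphU_deleteEdges (k : ℕ) (u : Fin 6) :
    (graphU u k).Connected ∧ gameDominationNumber (graphU u k) = 2 * k + 3 ∧
      ∀ e : Sym2 (Vertex (Fin 6) k),
        e = s(starVertex 0, starVertex 3) ∨ e = s(starVertex 0, starVertex 4) →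
        e ∈ (graphU u k).edgeSet ∧ ((graphU u k).deleteEdges {e}).Connected ∧
          gameDominationNumber ((graphU u k).deleteEdges {e}) = 2 * k + 5 :=
  attach_deleteEdges _ u 2 (fun _ => connected_graphU_without u) (moves_graphU_le u)
    (fun _ => le_gameDominationNumber_graphU_without u) k

theorem graphV_deleteEdges (k : ℕ) :
    (graphV k).Connected ∧ gameDominationNumber (graphV k) = 2 * k + 4 ∧
      ∀ e : Sym2 (Vertex (Fin 9) k),
        e = s(starVertex 0, starVertex 3) ∨ e = s(starVertex 0, starVertex 4) →
        e ∈ (graphV k).edgeSet ∧ ((graphV k).deleteEdges {e}).Connected ∧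
          gameDominationNumber ((graphV k).deleteEdges {e}) = 2 * k + 6 :=
  attach_deleteEdges _ 8 3 (fun _ => connected_graphV_without) moves_graphV_le
    (fun _ => le_gameDominationNumber_graphV_without) k

theorem exists_fin_of_finite {V : Type*} [Finite V] {G : SimpleGraph V} {e : Sym2 V} {ℓ : ℕ}
    (hG : G.Connected) (he : e ∈ G.edgeSet) (h : gameDominationNumber G = ℓ)
    (h' : gameDominationNumber (G.deleteEdges {e}) = ℓ + 2) :
    ∃ (n : ℕ) (G : SimpleGraph (Fin n)) (e : Sym2 (Fin n)), G.Connected ∧ e ∈ G.edgeSet ∧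
      gameDominationNumber G = ℓ ∧ gameDominationNumber (G.deleteEdges {e}) = ℓ + 2 := by
  obtain ⟨n, ⟨f⟩⟩ := Finite.exists_equiv_fin V
  let φ : G ≃g G.map f.toEmbedding := SimpleGraph.Iso.map f G
  refine ⟨n, _, e.map φ, φ.connected_iff.1 hG, ?_, ?_, ?_⟩
  · induction e using Sym2.ind with
    | _ a b => exact φ.map_adj_iff.2 he
  · rw [← gameDominationNumber_congr φ, h]
  · rw [← gameDominationNumber_congr (deleteEdgeIso φ e), h']

theorem gameDominationNumber_ne_zero {V : Type*} [Finite V] {G : SimpleGraph V} (v : V) :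
    gameDominationNumber G ≠ 0 := by
  have : 1 ≤ moves G .dominator ∅ := moves_pos fun h => (h ▸ Set.mem_univ v : v ∈ (∅ : Set V))
  rw [gameDominationNumber]
  omega

end DominationGame

theorem mainTheorem3 :
    -- every `ℓ ≥ 3` is realized by a connected graph
    (∀ ℓ : ℕ, 3 ≤ ℓ → ∃ (n : ℕ) (G : SimpleGraph (Fin n)) (e : Sym2 (Fin n)),
      G.Connected ∧ e ∈ G.edgeSet ∧
        gameDominationNumber G = ℓ ∧ gameDominationNumber (G.deleteEdges {e}) = ℓ + 2) ∧
    -- the graphs `U_k`, where `e` is either edge at `x` of the triangle in `B`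
    (∀ (k : ℕ) (u : Fin 6), (graphU u k).Connected ∧ gameDominationNumber (graphU u k) = 2 * k + 3 ∧
      ∀ e : Sym2 (Vertex (Fin 6) k), e = s(starVertex 0, starVertex 3) ∨ e = s(starVertex 0, starVertex 4) →
        e ∈ (graphU u k).edgeSet ∧ ((graphU u k).deleteEdges {e}).Connected ∧
          gameDominationNumber ((graphU u k).deleteEdges {e}) = 2 * k + 5) ∧
    -- the graphs `V_k`, with `e` as before
    (∀ k : ℕ, (graphV k).Connected ∧ gameDominationNumber (graphV k) = 2 * k + 4 ∧
      ∀ e : Sym2 (Vertex (Fin 9) k), e = s(starVertex 0, starVertex 3) ∨ e = s(starVertex 0, starVertex 4) →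
        e ∈ (graphV k).edgeSet ∧ ((graphV k).deleteEdges {e}).Connected ∧
          gameDominationNumber ((graphV k).deleteEdges {e}) = 2 * k + 6) ∧
    -- no graph, connected or not, realizes an `ℓ < 3`
    (∀ (W : Type*) [Finite W] (G : SimpleGraph W) (e : Sym2 W), e ∈ G.edgeSet →
      (gameDominationNumber G = 1 → gameDominationNumber (G.deleteEdges {e}) ≤ 2) ∧
      (gameDominationNumber G = 2 → gameDominationNumber (G.deleteEdges {e}) ≤ 3) ∧
      ∀ ℓ : ℕ, ℓ < 3 →
        ¬ (gameDominationNumber G = ℓ ∧ gameDominationNumber (G.deleteEdges {e}) = ℓ + 2)) := by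
  refine ⟨fun ℓ hℓ => ?_, graphU_deleteEdges, graphV_deleteEdges, fun W _ G e he => ?_⟩
  · rcases Nat.even_or_odd' ℓ with ⟨m, rfl | rfl⟩
    · obtain ⟨k, rfl⟩ : ∃ k, m = k + 2 := Nat.exists_eq_add_of_le' (by omega)
      obtain ⟨hG, hγ, h⟩ := graphV_deleteEdges k
      obtain ⟨he, -, hγ'⟩ := h _ (Or.inl rfl)
      exact exists_fin_of_finite hG he (by omega) (by omega)
    · obtain ⟨k, rfl⟩ : ∃ k, m = k + 1 := Nat.exists_eq_add_of_le' (by omega)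
      obtain ⟨hG, hγ, h⟩ := graphU_deleteEdges k 0
      obtain ⟨he, -, hγ'⟩ := h _ (Or.inl rfl)
      exact exists_fin_of_finite hG he (by omega) (by omega)
  · refine ⟨gameDominationNumber_deleteEdges_le_two e,
      gameDominationNumber_deleteEdges_le_three e, fun ℓ hℓ ⟨h, h'⟩ => ?_⟩
    have h0 : gameDominationNumber G ≠ 0 := by
      induction e using Sym2.ind with
      | _ a b => exact gameDominationNumber_ne_zero a
    have h1 := gameDominationNumber_deleteEdges_le_two (G := G) e
    have h2 := gameDominationNumber_deleteEdges_le_three (G := G) e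
    omega
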